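/- **Setting.** Consider a finite set $N$ of parties, party $k$ holding $\mathbb{C}^{d_k}$, and a complete orthonormal product basis $\mathcal S=\{|\psi^j\rangle=\bigotimes_k|\psi^j_k\rangle\}_j$ of $\bigotimes_k\mathbb{C}^{d_k}$ (so $|\mathcal S|=\prod_k d_k$), with all local vectors normalized. For each $k$ let the set $\mathcal S^{(k)}$ of distinct local vectors be partitioned into nonempty parts $\mathcal S^{(k)}_{x_k}$, $x_k\in\mathcal X_k$, of mutually orthogonal vectors, and let the vectors of each part be labelled injectively by $a_k\in\mathcal A_k=\{0,\dots,d_k-1\}$; thus $|\psi^j\rangle$ receives a label $(\bm a^j|\bm x^j)$. Call $\mathcal S$ *unambiguous* if, for every $k$, two distinct vectors of $\mathcal S^{(k)}$ are orthogonal if and only if they lie in the same part. Call $\mathcal S$ *QNLWE* (quantum nonlocality without entanglement) if no finite-round LOCC protocol identifies every element of $\mathcal S$ with certainty. A function $\bm w:\prod_k\mathcal A_k\to\prod_k\mathcal X_k$ is a *process function* if for all $f_k:\mathcal X_k\to\mathcal A_k$ the map $\bm w\circ(f_k)_k$ has exactly one fixed point. Under stochastic local operations $P(a_k,o_k|x_k,i_k)$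 it generates the correlation $P(\bm o|\bm i)=\sum_{\bm a}\prod_k P(a_k,o_k|w_k(\bm a),i_k)$. A correlation is *causal* if $P(\bm o|\bm i)=\sum_k q_kP_k(o_k|i_k)P_{k,i_k,o_k}(\bm o_{\setminus k}|\bm i_{\setminus k})$ with $q_k\ge 0$, $\sum_k q_k=1$, probability distributions $P_k$, and (recursively) causal correlations $P_{k,i_k,o_k}$ of the remaining parties. A process function is *causal* if all correlations it generates (with finite nonempty alphabets for $i_k,o_k$) are causal. A correlation is *2-causal* if $P(\bm o|\bm i)=\sum_{\emptyset\ne\mathcal K\subsetneq N}q_{\mathcal K}P_{\mathcal K}(\bm o_{\mathcal K}|\bm i_{\mathcal K})P_{\mathcal K,\bm i_{\mathcal K},\bm o_{\mathcal K}}(\bm o_{\setminus\mathcal K}|\bm i_{\setminus\mathcal K})$ with $q_{\mathcal K}\ge 0$, $\sum_{\mathcal K}q_{\mathcal K}=1$ and arbitrary probability distributions; a correlation of at least two parties that is not 2-causal is *genuinely multipartite non-causal*. A process function is *without global past* if none of its components $w_k$ is constant. For a set $\mathcal K$ of parties and fixed outputs $\bm a_{\mathcal K}$, the *output-reduced* function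 $\bm w^{\bm a_{\mathcal K}}$ sends $\bm a_{\setminus\mathcal K}$ to $(w_k(\bm a_{\mathcal K},\bm a_{\setminus\mathcal K}))_{k\notin\mathcal K}$. **Statement.** Let $\mathcal S$ be an unambiguous complete product basis, labelled as above, that is QNLWE. Then there is exactly one function $\bm w$ with $\bm w(\bm a^j)=\bm x^j$ for all $j$; it is a process function, and it is not causal. Moreover, one of the following holds: 1. $\bm w$ is without global past; or 2. $\bm w$ has a constant component and generates no genuinely multipartite non-causal correlation, and there are a set $\mathcal K$ of parties, $\emptyset\ne\mathcal K\subsetneq N$, and outputs $\bm a_{\mathcal K}$ such that $\bm w^{\bm a_{\mathcal K}}$ is a process function without global past that generates genuinely multipartite non-causal correlations of the parties outside $\mathcal K$. -/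

import Mathlib

open scoped Matrix

universe u v

noncomputable section

/-! ### Process functions -/

section Processes

variable {ι : Type u} {A X : ι → Type}

/-- Logical consistency of a deterministic process `w`: for every choice of local interventions
`f k : X k → A k`, the map `w ∘ f` has exactly one fixed point. -/
def IsProcessFunction (w : (∀ k, A k) → ∀ k, X k) : Prop :=
  ∀ f : ∀ k, X k → A k, ∃! x : ∀ k, X k, w (fun k => f k (x k)) = x

/-- No party lies in the global past of all others: no component of `w` is constant. -/
def WithoutGlobalPast (w : (∀ k, A k) → ∀ k, X k) : Prop :=
  ∀ k, ¬ ∃ x : X k, ∀ a, w a k = x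

variable [DecidableEq ι]

/-- The tuple with entries `aK` on the set `K` of parties and `b` outside `K`. -/
def mergeOutputs (K : Finset ι) (aK : ∀ k : {k // k ∈ K}, A k) (b : ∀ k : {k // k ∉ K}, A k) :
    ∀ k, A k :=
  fun k => if h : k ∈ K then aK ⟨k, h⟩ else b ⟨k, h⟩

/-- The output-reduced function: every party `k ∈ K` feeds the constant output `aK k` into the
process, and the inputs of the remaining parties are kept. -/
def outputReduced (w : (∀ k, A k) → ∀ k, X k) (K : Finset ι) (aK : ∀ k : {k // k ∈ K}, A k) :
    (∀ k : {k // k ∉ K}, A k) → ∀ k : {k // k ∉ K}, X k :=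
  fun b k => w (mergeOutputs K aK b) k

end Processes

/-! ### Correlations, causal correlations, causal process functions -/

/-- Candidate multipartite correlations: `P i o` stands for `P(o|i)`. -/
abbrev Correlation {ι : Type u} (I O : ι → Type) : Type u :=
  (∀ k, I k) → (∀ k, O k) → ℝ

/-- `P` is a conditional probability distribution. -/
def IsDistribution {ι : Type u} [Fintype ι] [DecidableEq ι] {I O : ι → Type}
    [∀ k, Fintype (O k)] (P : Correlation I O) : Prop :=
  (∀ i o, 0 ≤ P i o) ∧ ∀ i, ∑ o, P i o = 1

/-- A stochastic local operation of one party: `L x i a o` stands for `P(a,o|x,i)`. -/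
def IsLocalOperation {X I A O : Type} [Fintype A] [Fintype O] (L : X → I → A → O → ℝ) : Prop :=
  (∀ x i a o, 0 ≤ L x i a o) ∧ ∀ x i, ∑ a, ∑ o, L x i a o = 1

/-- The correlation generated by `w` and the local operations `L`; the sum over `x` against the
Kronecker delta of `x` and `w a` has been carried out. -/
def generatedCorrelation {ι : Type u} [Fintype ι] [DecidableEq ι] {A X I O : ι → Type}
    [∀ k, Fintype (A k)] (w : (∀ k, A k) → ∀ k, X k)
    (L : ∀ k, X k → I k → A k → O k → ℝ) : Correlation I O :=
  fun i o => ∑ a : ∀ k, A k, ∏ k, L k (w a k) (i k) (a k) (o k)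

/-- Causal correlations of `n` parties, by recursion on `n`: convex combinations over `k` of
`P_k(o_k|i_k)` times an `(n-1)`-partite causal correlation of the other parties that may depend
on `k`, `i_k` and `o_k`. Only used with `n` the number of parties. -/
def CausalCorrelationAux : (n : ℕ) → {ι : Type u} → [Fintype ι] → [DecidableEq ι] →
    {I O : ι → Type} → [∀ k, Fintype (O k)] → Correlation I O → Prop
  | 0, _, _, _, _, _, _, P => ∀ i o, P i o = 1
  | n + 1, ι, _, _, I, O, _, P =>
      ∃ (q : ι → ℝ) (P₁ : ∀ k, I k → O k → ℝ)
        (R : ∀ k, I k → O k →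
          Correlation (fun l : {l : ι // l ≠ k} => I l) (fun l : {l : ι // l ≠ k} => O l)),
        (∀ k, 0 ≤ q k) ∧ ∑ k, q k = 1 ∧
        (∀ k i o, 0 ≤ P₁ k i o) ∧ (∀ k i, ∑ o, P₁ k i o = 1) ∧
        (∀ k i o, CausalCorrelationAux n (R k i o)) ∧
        ∀ i o, P i o =
          ∑ k, q k * P₁ k (i k) (o k) * R k (i k) (o k) (fun l => i l) (fun l => o l)

/-- Multipartite causal correlations. -/
def IsCausalCorrelation {ι : Type u} [Fintype ι] [DecidableEq ι] {I O : ι → Type}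
    [∀ k, Fintype (O k)] (P : Correlation I O) : Prop :=
  CausalCorrelationAux (Fintype.card ι) P

/-- 2-causal correlations: convex combinations, over nonempty strict subsets `K` of parties, of
`P_K(o_K|i_K)` times a correlation of the other parties that may depend on `K`, `i_K`, `o_K`. -/
def IsTwoCausalCorrelation {ι : Type u} [Fintype ι] [DecidableEq ι] {I O : ι → Type}
    [∀ k, Fintype (O k)] (P : Correlation I O) : Prop :=
  ∃ (q : {K : Finset ι // K.Nonempty ∧ K ≠ Finset.univ} → ℝ)
    (PK : ∀ K : {K : Finset ι // K.Nonempty ∧ K ≠ Finset.univ},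
      Correlation (fun k : {k // k ∈ K.1} => I k) (fun k : {k // k ∈ K.1} => O k))
    (R : ∀ K : {K : Finset ι // K.Nonempty ∧ K ≠ Finset.univ},
      (∀ k : {k // k ∈ K.1}, I k) → (∀ k : {k // k ∈ K.1}, O k) →
      Correlation (fun k : {k // k ∉ K.1} => I k) (fun k : {k // k ∉ K.1} => O k)),
    (∀ K, 0 ≤ q K) ∧ ∑ K, q K = 1 ∧
    (∀ K, IsDistribution (PK K)) ∧ (∀ K iK oK, IsDistribution (R K iK oK)) ∧
    ∀ i o, P i o =
      ∑ K, q K * PK K (fun k => i k) (fun k => o k) *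
        R K (fun k => i k) (fun k => o k) (fun k => i k) (fun k => o k)

/-- A causal process function generates causal correlations under all local operations. -/
def IsCausalProcess {ι : Type u} [Fintype ι] [DecidableEq ι] {A X : ι → Type}
    [∀ k, Fintype (A k)] (w : (∀ k, A k) → ∀ k, X k) : Prop :=
  ∀ (I O : ι → Type) [∀ k, Fintype (I k)] [∀ k, Nonempty (I k)] [∀ k, Fintype (O k)]
    [∀ k, Nonempty (O k)] (L : ∀ k, X k → I k → A k → O k → ℝ),
    (∀ k, IsLocalOperation (L k)) → IsCausalCorrelation (generatedCorrelation w L)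

/-- `w` (with at least two parties) generates a genuinely multipartite non-causal correlation,
i.e. one that is not 2-causal, under some local operations. -/
def GeneratesGenuineNonCausality {ι : Type u} [Fintype ι] [DecidableEq ι] {A X : ι → Type}
    [∀ k, Fintype (A k)] (w : (∀ k, A k) → ∀ k, X k) : Prop :=
  1 < Fintype.card ι ∧
  ∃ (I O : ι → Type) (_ : ∀ k, Fintype (I k)) (_ : ∀ k, Nonempty (I k))
    (_ : ∀ k, Fintype (O k)) (_ : ∀ k, Nonempty (O k)) (L : ∀ k, X k → I k → A k → O k → ℝ),
    (∀ k, IsLocalOperation (L k)) ∧ ¬ IsTwoCausalCorrelation (generatedCorrelation w L)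

/-! ### LOCC -/

/-- The Hilbert space of the parties `k : ι` with local dimensions `d k`, i.e. the tensor product
of the `ℂ ^ (d k)`, in coordinates with respect to the product of the standard bases. -/
abbrev JointSpace {ι : Type u} [Fintype ι] [DecidableEq ι] (d : ι → ℕ) : Type u :=
  EuclideanSpace ℂ (∀ k, Fin (d k))

/-- Finite-round LOCC protocols with final result in `R`. In a round each party `k` applies to its
system a measurement with Kraus operators `K k s` (possibly only the trivial one) and broadcasts
the outcome `s`; what is done next may depend on everything that was broadcast. Post-measurement
local dimensions `e k s` are arbitrary, so that local ancillas are included. Measuring one Kraus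
operator per outcome and broadcasting every outcome is no restriction, since the continuation may
ignore part of the information. -/
inductive LOCCProtocol {ι : Type u} (R : Type v) : (ι → ℕ) → Type (max u v)
  | halt (d : ι → ℕ) (r : R) : LOCCProtocol R d
  | round (d : ι → ℕ) (m : ι → ℕ) (e : ∀ k, Fin (m k) → ℕ)
      (K : ∀ k (s : Fin (m k)), Matrix (Fin (e k s)) (Fin (d k)) ℂ)
      (complete : ∀ k, ∑ s, (K k s)ᴴ * K k s = 1)
      (next : ∀ s : (∀ k, Fin (m k)), LOCCProtocol R (fun k => e k (s k))) :
      LOCCProtocol R d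

/-- The action of the tensor product of the local operators `M k` on a joint vector. -/
def applyLocal {ι : Type u} [Fintype ι] [DecidableEq ι] {d e : ι → ℕ}
    (M : ∀ k, Matrix (Fin (e k)) (Fin (d k)) ℂ) (ψ : JointSpace d) : JointSpace e :=
  WithLp.toLp 2 (fun b => ∑ a : ∀ k, Fin (d k), (∏ k, M k (b k) (a k)) * ψ a)

open Classical in
/-- The probability (Born rule) that the protocol ends with result `r` on the joint state `ψ`. -/
def LOCCProtocol.prob {ι : Type u} [Fintype ι] [DecidableEq ι] {R : Type v} :
    {d : ι → ℕ} → LOCCProtocol R d → JointSpace d → R → ℝ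
  | _, .halt _ r', ψ, r => if r' = r then ‖ψ‖ ^ 2 else 0
  | _, .round _ _ _ K _ next, ψ, r =>
      ∑ s, (next s).prob (applyLocal (fun k => K k (s k)) ψ) r

/-! ### Complete product bases, event labels, unambiguity -/

/-- Complete orthonormal product bases, indexed by `J`: the `j`-th element is the tensor product
of the local unit vectors `vec j k`. -/
structure ProductBasis {ι : Type u} [Fintype ι] [DecidableEq ι] (d : ι → ℕ)
    (J : Type v) [Fintype J] where
  vec : J → ∀ k, EuclideanSpace ℂ (Fin (d k))
  norm_vec : ∀ j k, ‖vec j k‖ = 1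
  orthogonal : ∀ i j, i ≠ j →
    inner ℂ (WithLp.toLp 2 (fun a => ∏ k, vec i k (a k)) : JointSpace d)
      (WithLp.toLp 2 (fun a => ∏ k, vec j k (a k)) : JointSpace d) = 0
  complete : Fintype.card J = ∏ k, d k

namespace ProductBasis

variable {ι : Type u} [Fintype ι] [DecidableEq ι] {d : ι → ℕ} {J : Type v} [Fintype J]

/-- The `j`-th basis vector. -/
def state (S : ProductBasis d J) (j : J) : JointSpace d :=
  WithLp.toLp 2 (fun a => ∏ k, S.vec j k (a k))

/-- Some finite-round LOCC protocol identifies every element of the basis with certainty. -/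
def LOCCDistinguishable (S : ProductBasis d J) : Prop :=
  ∃ p : LOCCProtocol J d, ∀ j, p.prob (S.state j) j = 1

/-- Quantum nonlocality without entanglement. -/
def IsQNLWE (S : ProductBasis d J) : Prop :=
  ¬ S.LOCCDistinguishable

end ProductBasis

/-- For each party `k`, a partition of the set of distinct local vectors into nonempty parts of
mutually orthogonal vectors, indexed by the settings `X k`, and an injective labelling of the
vectors of each part by outcomes in `Fin (d k)`. The label of `vec j k` is
`(outcome j k | setting j k)`. -/
structure EventLabelling {ι : Type u} [Fintype ι] [DecidableEq ι] {d : ι → ℕ} {J : Type v}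
    [Fintype J] (S : ProductBasis d J) (X : ι → Type) where
  setting : J → ∀ k, X k
  outcome : J → ∀ k, Fin (d k)
  vec_eq_iff : ∀ k i j, S.vec i k = S.vec j k ↔
    setting i k = setting j k ∧ outcome i k = outcome j k
  orthogonal_of_setting_eq : ∀ k i j, setting i k = setting j k → S.vec i k ≠ S.vec j k →
    inner ℂ (S.vec i k) (S.vec j k) = 0
  setting_surjective : ∀ k (x : X k), ∃ j, setting j k = x

namespace EventLabelling

variable {ι : Type u} [Fintype ι] [DecidableEq ι] {d : ι → ℕ} {J : Type v} [Fintype J]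
  {S : ProductBasis d J} {X : ι → Type}

/-- Two distinct local vectors of a party are orthogonal iff they have the same setting. -/
def Unambiguous (E : EventLabelling S X) : Prop :=
  ∀ k i j, S.vec i k ≠ S.vec j k →
    (inner ℂ (S.vec i k) (S.vec j k) = 0 ↔ E.setting i k = E.setting j k)

/-- `w` sends the joint outcome of each basis element to its joint setting. -/
def Induces (E : EventLabelling S X) (w : (∀ k, Fin (d k)) → ∀ k, X k) : Prop :=
  ∀ j, w (E.outcome j) = E.setting j

end EventLabelling

end

/-! ### Logical consistency and normalization -/

section Consistency

variable {ι : Type u} {A X : ι → Type}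

/-- Any two distinct output tuples differ at a party that receives the same input in both cases. -/
def IsConsistent (w : (∀ k, A k) → ∀ k, X k) : Prop :=
  ∀ a b, a ≠ b → ∃ k, a k ≠ b k ∧ w a k = w b k

theorem IsConsistent.outputReduced [DecidableEq ι] {w : (∀ k, A k) → ∀ k, X k}
    (hw : IsConsistent w) (K : Finset ι) (aK : ∀ k : {k // k ∈ K}, A k) :
    IsConsistent (outputReduced w K aK) := by
  intro a b hab
  have hne : mergeOutputs K aK a ≠ mergeOutputs K aK b := by
    intro h
    apply hab
    funext k
    have := congrFun h k
    simpa [mergeOutputs, k.2] using this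
  obtain ⟨k, hk, hk'⟩ := hw _ _ hne
  by_cases h : k ∈ K
  · simp [mergeOutputs, h] at hk
  · refine ⟨⟨k, h⟩, ?_, hk'⟩
    simpa [mergeOutputs, h] using hk

/-- The input of a party does not depend on its own output. -/
theorem IsConsistent.apply_eq {w : (∀ k, A k) → ∀ k, X k} (hw : IsConsistent w) {k : ι}
    {a b : ∀ k, A k} (h : ∀ l, l ≠ k → a l = b l) : w a k = w b k := by
  by_cases hab : a = b
  · rw [hab]
  obtain ⟨l, hl, hl'⟩ := hw a b hab
  by_cases hlk : l = k
  · rwa [hlk] at hl'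
  · exact absurd (h l hlk) hl

open Classical in
theorem sum_prod_ite_eq {X A : Type} [Fintype X] [Fintype A] (m : X → A → ℝ)
    (hm : ∀ x, ∑ a, m x a = 1) (x₀ : X) (a₀ : A) :
    ∑ g : X → A, (∏ x, m x (g x)) * (if g x₀ = a₀ then 1 else 0) = m x₀ a₀ := by
  have h1 : ∀ g : X → A, (∏ x, m x (g x)) * (if g x₀ = a₀ then (1 : ℝ) else 0) =
      ∏ x, m x (g x) * (if x = x₀ then (if g x = a₀ then 1 else 0) else 1) := by
    intro g
    rw [Finset.prod_mul_distrib]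
    congr 1
    simp
  simp_rw [h1]
  rw [← Fintype.prod_sum (fun x b => m x b * (if x = x₀ then (if b = a₀ then 1 else 0) else 1))]
  rw [Finset.prod_eq_single x₀]
  · simp
  · intro x _ hx
    simp [hx, hm]
  · simp

variable [Fintype ι] [DecidableEq ι] [∀ k, Fintype (A k)]

open Classical in
theorem sum_prod_eq_sum_fixedPoints [∀ k, Fintype (X k)] (w : (∀ k, A k) → ∀ k, X k)
    (M : ∀ k, X k → A k → ℝ) (hM : ∀ k x, ∑ a, M k x a = 1) :
    ∑ a, ∏ k, M k (w a k) (a k) =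
      ∑ f : ∀ k, X k → A k, (∏ k, ∏ x, M k x (f k x)) *
        ((Finset.univ.filter fun a : ∀ k, A k => ∀ k, f k (w a k) = a k).card : ℝ) := by
  have h1 : ∀ a : ∀ k, A k, ∏ k, M k (w a k) (a k) =
      ∑ f : ∀ k, X k → A k, (∏ k, ∏ x, M k x (f k x)) *
        (if ∀ k, f k (w a k) = a k then 1 else 0) := by
    intro a
    have h2 : ∀ k, M k (w a k) (a k) = ∑ g : X k → A k,
        (∏ x, M k x (g x)) * (if g (w a k) = a k then 1 else 0) := fun k =>
      (sum_prod_ite_eq (M k) (hM k) (w a k) (a k)).symm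
    simp_rw [h2]
    rw [Fintype.prod_sum]
    refine Finset.sum_congr rfl fun f _ => ?_
    rw [Finset.prod_mul_distrib, Finset.prod_ite_zero]
    simp
  simp_rw [h1]
  rw [Finset.sum_comm]
  refine Finset.sum_congr rfl fun f _ => ?_
  rw [← Finset.mul_sum]
  simp

open Classical in
theorem IsConsistent.card_fixedPoints_le {w : (∀ k, A k) → ∀ k, X k} (hw : IsConsistent w)
    (f : ∀ k, X k → A k) :
    (Finset.univ.filter fun a : ∀ k, A k => ∀ k, f k (w a k) = a k).card ≤ 1 := by
  rw [Finset.card_le_one]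
  intro a ha b hb
  simp only [Finset.mem_filter, Finset.mem_univ, true_and] at ha hb
  by_contra hab
  obtain ⟨k, hk, hk'⟩ := hw a b hab
  exact hk (by rw [← ha k, ← hb k, hk'])

theorem sum_prod_prod_eq_one [∀ k, Fintype (X k)] [∀ k, DecidableEq (X k)]
    (M : ∀ k, X k → A k → ℝ) (hM : ∀ k x, ∑ a, M k x a = 1) :
    ∑ f : ∀ k, X k → A k, ∏ k, ∏ x, M k x (f k x) = 1 := by
  rw [← Fintype.prod_sum (fun k (g : X k → A k) => ∏ x, M k x (g x))]
  refine Finset.prod_eq_one fun k _ => ?_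
  rw [← Fintype.prod_sum]
  exact Finset.prod_eq_one fun x _ => hM k x

open Classical in
theorem IsConsistent.card_fixedPoints [∀ k, Finite (X k)] [∀ k, Nonempty (A k)]
    {w : (∀ k, A k) → ∀ k, X k} (hw : IsConsistent w) (f : ∀ k, X k → A k) :
    (Finset.univ.filter fun a : ∀ k, A k => ∀ k, f k (w a k) = a k).card = 1 := by
  have (k : ι) : Fintype (X k) := Fintype.ofFinite _
  let M : ∀ k, X k → A k → ℝ := fun k _ _ => (Fintype.card (A k) : ℝ)⁻¹
  have hcard : ∀ k, (0 : ℝ) < Fintype.card (A k) := fun k => by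
    exact_mod_cast Fintype.card_pos
  have hM : ∀ k x, ∑ a, M k x a = 1 := fun k x => by
    simp [M, (hcard k).ne']
  have h1 : ∑ a, ∏ k, M k (w a k) (a k) = 1 := by
    simp only [M, Finset.sum_const, Finset.card_univ, nsmul_eq_mul, Fintype.card_pi]
    push_cast
    rw [← Finset.prod_mul_distrib]
    exact Finset.prod_eq_one fun k _ => mul_inv_cancel₀ (hcard k).ne'
  rw [sum_prod_eq_sum_fixedPoints w M hM] at h1
  refine le_antisymm (hw.card_fixedPoints_le f) ?_
  by_contra hlt
  have hlt' : (Finset.univ.filter fun a : ∀ k, A k => ∀ k, f k (w a k) = a k).card = 0 := by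
    omega
  have hpos : ∀ g : ∀ k, X k → A k, 0 < ∏ k, ∏ x, M k x (g k x) := fun g =>
    Finset.prod_pos fun k _ => Finset.prod_pos fun x _ => inv_pos.2 (hcard k)
  have h2 : ∑ g : ∀ k, X k → A k, (∏ k, ∏ x, M k x (g k x)) *
        ((Finset.univ.filter fun a : ∀ k, A k => ∀ k, g k (w a k) = a k).card : ℝ) <
      ∑ g : ∀ k, X k → A k, ∏ k, ∏ x, M k x (g k x) := by
    refine Finset.sum_lt_sum (fun g _ => ?_) ⟨f, Finset.mem_univ _, ?_⟩
    · exact mul_le_of_le_one_right (hpos g).le (by exact_mod_cast hw.card_fixedPoints_le g)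
    · rw [hlt']
      simpa using hpos f
  rw [h1, sum_prod_prod_eq_one M hM] at h2
  exact lt_irrefl _ h2

theorem IsConsistent.sum_prod_eq_one [∀ k, Finite (X k)] [∀ k, Nonempty (A k)]
    {w : (∀ k, A k) → ∀ k, X k} (hw : IsConsistent w) (M : ∀ k, X k → A k → ℝ)
    (hM : ∀ k x, ∑ a, M k x a = 1) : ∑ a, ∏ k, M k (w a k) (a k) = 1 := by
  classical
  have (k : ι) : Fintype (X k) := Fintype.ofFinite _
  rw [sum_prod_eq_sum_fixedPoints w M hM]
  simp_rw [hw.card_fixedPoints]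
  simpa using sum_prod_prod_eq_one M hM

theorem IsConsistent.isProcessFunction [∀ k, Finite (X k)] [∀ k, Nonempty (A k)]
    {w : (∀ k, A k) → ∀ k, X k} (hw : IsConsistent w) : IsProcessFunction w := by
  classical
  intro f
  obtain ⟨a, ha⟩ := Finset.card_eq_one.1 (hw.card_fixedPoints f)
  have key : ∀ b : ∀ k, A k, (∀ k, f k (w b k) = b k) ↔ b = a := fun b => by
    simpa using Finset.ext_iff.1 ha b
  have ha' := funext ((key a).2 rfl)
  refine ⟨w a, by simp only [ha'], fun y hy => ?_⟩
  have := (key (fun k => f k (y k))).1 fun k => by rw [hy]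
  rw [← hy, this]

theorem IsConsistent.isDistribution_generatedCorrelation [∀ k, Finite (X k)]
    [∀ k, Nonempty (A k)] {w : (∀ k, A k) → ∀ k, X k} (hw : IsConsistent w) {I O : ι → Type}
    [∀ k, Fintype (O k)] (L : ∀ k, X k → I k → A k → O k → ℝ)
    (hL : ∀ k, IsLocalOperation (L k)) : IsDistribution (generatedCorrelation w L) := by
  refine ⟨fun i o => Finset.sum_nonneg fun a _ => Finset.prod_nonneg fun k _ =>
    (hL k).1 _ _ _ _, fun i => ?_⟩
  unfold generatedCorrelation
  rw [Finset.sum_comm]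
  rw [← hw.sum_prod_eq_one (fun k x a => ∑ o, L k x (i k) a o) fun k x => (hL k).2 x (i k)]
  refine Finset.sum_congr rfl fun a _ => ?_
  rw [Fintype.prod_sum (fun k o => L k (w a k) (i k) (a k) o)]

end Consistency

/-! ### Parties with a constant input -/

section ConstantInputs

variable {ι : Type u} [Fintype ι] [DecidableEq ι] {A X I O : ι → Type} [∀ k, Fintype (A k)]

theorem sum_eq_sum_mergeOutputs (K : Finset ι) (F : (∀ k, A k) → ℝ) :
    ∑ a, F a = ∑ aK : ∀ k : {k // k ∈ K}, A k, ∑ b : ∀ k : {k // k ∉ K}, A k,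
      F (mergeOutputs K aK b) := by
  rw [← Fintype.sum_prod_type']
  exact Fintype.sum_equiv (Equiv.piEquivPiSubtypeProd (fun k => k ∈ K) A) _ _ fun a => by
    congr 1
    funext k
    simp [mergeOutputs, Equiv.piEquivPiSubtypeProd]

theorem generatedCorrelation_eq_sum_outputReduced {w : (∀ k, A k) → ∀ k, X k} {K : Finset ι}
    {x : ∀ k : {k // k ∈ K}, X k} (hx : ∀ a (k : {k // k ∈ K}), w a k = x k)
    (L : ∀ k, X k → I k → A k → O k → ℝ) (i : ∀ k, I k) (o : ∀ k, O k) :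
    generatedCorrelation w L i o = ∑ aK : ∀ k : {k // k ∈ K}, A k,
      (∏ k : {k // k ∈ K}, L k (x k) (i k) (aK k) (o k)) *
        generatedCorrelation (outputReduced w K aK) (fun k => L k) (fun k => i k)
          (fun k => o k) := by
  unfold generatedCorrelation
  rw [sum_eq_sum_mergeOutputs K]
  refine Finset.sum_congr rfl fun aK _ => ?_
  rw [Finset.mul_sum]
  refine Finset.sum_congr rfl fun b _ => ?_
  rw [← Fintype.prod_subtype_mul_prod_subtype (fun k => k ∈ K)]
  congr 1
  · refine Finset.prod_congr (by ext; simp) fun k _ => ?_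
    rw [hx]
    simp [mergeOutputs, k.2]
  · refine Finset.prod_congr rfl fun k _ => ?_
    simp [mergeOutputs, k.2, outputReduced]

variable [∀ k, Fintype (O k)]

theorem exists_isDistribution [∀ k, Nonempty (O k)] : ∃ P : Correlation I O, IsDistribution P := by
  classical
  refine ⟨fun _ o => if o = Classical.arbitrary _ then 1 else 0, fun i o => ?_, fun i => ?_⟩
  · dsimp only
    split_ifs <;> norm_num
  · simp

theorem exists_factorization [∀ k, Finite (X k)] [∀ k, Nonempty (A k)] [∀ k, Nonempty (O k)]
    {w : (∀ k, A k) → ∀ k, X k} (hw : IsConsistent w) {K : Finset ι}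
    {x : ∀ k : {k // k ∈ K}, X k} (hx : ∀ a (k : {k // k ∈ K}), w a k = x k)
    (L : ∀ k, X k → I k → A k → O k → ℝ) (hL : ∀ k, IsLocalOperation (L k)) :
    ∃ (PK : Correlation (fun k : {k // k ∈ K} => I k) (fun k : {k // k ∈ K} => O k))
      (R : (∀ k : {k // k ∈ K}, I k) → (∀ k : {k // k ∈ K}, O k) →
        Correlation (fun k : {k // k ∉ K} => I k) (fun k : {k // k ∉ K} => O k)),
      IsDistribution PK ∧ (∀ iK oK, IsDistribution (R iK oK)) ∧
      ∀ i o, generatedCorrelation w L i o = PK (fun k => i k) (fun k => o k) *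
        R (fun k => i k) (fun k => o k) (fun k => i k) (fun k => o k) := by
  obtain ⟨D, hD⟩ := exists_isDistribution (I := fun k : {k // k ∉ K} => I k)
    (O := fun k : {k // k ∉ K} => O k)
  let PK : Correlation (fun k : {k // k ∈ K} => I k) (fun k : {k // k ∈ K} => O k) :=
    fun iK oK => ∑ aK : ∀ k : {k // k ∈ K}, A k,
      ∏ k : {k // k ∈ K}, L k (x k) (iK k) (aK k) (oK k)
  have hterm : ∀ (iK : ∀ k : {k // k ∈ K}, I k) (oK : ∀ k : {k // k ∈ K}, O k)
      (aK : ∀ k : {k // k ∈ K}, A k),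
      0 ≤ ∏ k : {k // k ∈ K}, L k (x k) (iK k) (aK k) (oK k) := fun iK oK aK =>
    Finset.prod_nonneg fun k _ => (hL k).1 _ _ _ _
  have hred : ∀ aK, IsDistribution (generatedCorrelation (outputReduced w K aK)
      (fun k : {k // k ∉ K} => L k)) := fun aK =>
    (hw.outputReduced K aK).isDistribution_generatedCorrelation _ fun k => hL k
  have hPK : IsDistribution PK :=
    IsConsistent.isDistribution_generatedCorrelation
      (w := fun (_ : ∀ k : {k // k ∈ K}, A k) k => x k)
      (fun a b hab => (Function.ne_iff.1 hab).imp fun k hk => ⟨hk, rfl⟩)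
      (fun k => L k) fun k => hL k
  let R : (∀ k : {k // k ∈ K}, I k) → (∀ k : {k // k ∈ K}, O k) →
      Correlation (fun k : {k // k ∉ K} => I k) (fun k : {k // k ∉ K} => O k) :=
    fun iK oK i o => if PK iK oK = 0 then D i o else
      (∑ aK : ∀ k : {k // k ∈ K}, A k,
        (∏ k : {k // k ∈ K}, L k (x k) (iK k) (aK k) (oK k)) *
        generatedCorrelation (outputReduced w K aK) (fun k => L k) i o) / PK iK oK
  refine ⟨PK, R, hPK, fun iK oK => ?_, fun i o => ?_⟩
  · by_cases h0 : PK iK oK = 0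
    · simpa [R, h0] using hD
    · simp only [R, h0, if_false]
      refine ⟨fun i o => div_nonneg (Finset.sum_nonneg fun aK _ =>
        mul_nonneg (hterm _ _ _) ((hred aK).1 _ _)) (hPK.1 _ _), fun i => ?_⟩
      rw [← Finset.sum_div, Finset.sum_comm, div_eq_one_iff_eq h0]
      refine Finset.sum_congr rfl fun aK _ => ?_
      rw [← Finset.mul_sum, (hred aK).2, mul_one]
  · rw [generatedCorrelation_eq_sum_outputReduced hx]
    by_cases h0 : PK (fun k => i k) (fun k => o k) = 0
    · rw [h0, zero_mul]
      refine Finset.sum_eq_zero fun aK _ => ?_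
      rw [(Finset.sum_eq_zero_iff_of_nonneg fun a _ => hterm _ _ a).1 h0 aK (Finset.mem_univ _),
        zero_mul]
    · simp only [R, h0, if_false]
      rw [mul_div_cancel₀ _ h0]

theorem not_generatesGenuineNonCausality [∀ k, Finite (X k)] [∀ k, Nonempty (A k)]
    {w : (∀ k, A k) → ∀ k, X k} (hw : IsConsistent w) (hpast : ¬ WithoutGlobalPast w) :
    ¬ GeneratesGenuineNonCausality w := by
  rintro ⟨hcard, I, O, _, _, _, _, L, hL, hP⟩
  simp only [WithoutGlobalPast, not_forall, not_not] at hpast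
  obtain ⟨k, x, hx⟩ := hpast
  have hne : ({k} : Finset ι) ≠ Finset.univ := fun h => by
    have := congrArg Finset.card h
    rw [Finset.card_singleton, Finset.card_univ] at this
    omega
  apply hP
  have hfac : ∀ K : {K : Finset ι // K.Nonempty ∧ K ≠ Finset.univ},
      ∃ (PK : Correlation (fun k : {k // k ∈ K.1} => I k) (fun k : {k // k ∈ K.1} => O k))
        (R : (∀ k : {k // k ∈ K.1}, I k) → (∀ k : {k // k ∈ K.1}, O k) →
          Correlation (fun k : {k // k ∉ K.1} => I k) (fun k : {k // k ∉ K.1} => O k)),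
        IsDistribution PK ∧ (∀ iK oK, IsDistribution (R iK oK)) ∧
        (K.1 = {k} → ∀ i o, generatedCorrelation w L i o = PK (fun k => i k) (fun k => o k) *
          R (fun k => i k) (fun k => o k) (fun k => i k) (fun k => o k)) := by
    intro K
    by_cases hK : K.1 = {k}
    · have hxK : ∀ a (l : {l // l ∈ K.1}), w a l = w (fun _ => Classical.arbitrary _) l := by
        rintro a ⟨l, hl⟩
        rw [hK, Finset.mem_singleton] at hl
        subst hl
        rw [hx, hx]
      obtain ⟨PK, R, h1, h2, h3⟩ := exists_factorization hw hxK L hL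
      exact ⟨PK, R, h1, h2, fun _ => h3⟩
    · obtain ⟨D, hD⟩ := exists_isDistribution (I := fun k : {k // k ∈ K.1} => I k)
        (O := fun k : {k // k ∈ K.1} => O k)
      obtain ⟨D', hD'⟩ := exists_isDistribution (I := fun k : {k // k ∉ K.1} => I k)
        (O := fun k : {k // k ∉ K.1} => O k)
      exact ⟨D, fun _ _ => D', hD, fun _ _ => hD', fun h => absurd h hK⟩
  choose PK R h1 h2 h3 using hfac
  let K₀ : {K : Finset ι // K.Nonempty ∧ K ≠ Finset.univ} :=
    ⟨{k}, Finset.singleton_nonempty k, hne⟩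
  refine ⟨fun K => if K = K₀ then 1 else 0, PK, R, fun K => ?_, ?_, h1, h2, fun i o => ?_⟩
  · dsimp only
    split_ifs <;> norm_num
  · simp
  · rw [h3 K₀ rfl, Finset.sum_eq_single K₀]
    · simp
    · intro K _ hK
      simp [hK]
    · simp

end ConstantInputs

/-! ### Cylinders without a constant component -/

section Ordered

variable {ι : Type u} {A X : ι → Type}

/-- Once the parties in `K` have produced the outputs of `a`, the input of `l` is determined. -/
def DeterminedAfter (w : (∀ k, A k) → ∀ k, X k) (K : Finset ι) (a : ∀ k, A k) (l : ι) : Prop :=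
  ∀ b c : ∀ k, A k, (∀ k ∈ K, b k = a k) → (∀ k ∈ K, c k = a k) → w b l = w c l

/-- Whatever a strict subset of the parties has output, the input of a further party is
determined. -/
def IsDynamicallyOrdered [Fintype ι] (w : (∀ k, A k) → ∀ k, X k) : Prop :=
  ∀ K : Finset ι, K ≠ Finset.univ → ∀ a, ∃ l ∉ K, DeterminedAfter w K a l

theorem withoutGlobalPast_outputReduced [DecidableEq ι] {w : (∀ k, A k) → ∀ k, X k}
    {K : Finset ι} {a : ∀ k, A k} (h : ∀ l ∉ K, ¬ DeterminedAfter w K a l) :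
    WithoutGlobalPast (outputReduced w K fun k => a k) := by
  rintro ⟨l, hl⟩ ⟨x, hx⟩
  have key : ∀ b : ∀ k, A k, (∀ k ∈ K, b k = a k) → w b l = x := fun b hb => by
    rw [← hx fun k => b k]
    congr 1
    funext k
    by_cases hk : k ∈ K <;> simp [mergeOutputs, hk, hb]
  exact h l hl fun b c hb hc => by rw [key b hb, key c hc]

end Ordered

/-! ### Interventions that reveal the input -/

section Revealing

variable {ι : Type u} {A X : ι → Type}

open Classical in
/-- The party applies the function it is given to the input and reveals the input. -/
noncomputable def revealingOperation (X A : Type) : X → (X → A) → A → X → ℝ :=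
  fun x f a o => if a = f x ∧ o = x then 1 else 0

theorem isLocalOperation_revealingOperation (X A : Type) [Fintype X] [Fintype A] :
    IsLocalOperation (revealingOperation X A) := by
  classical
  refine ⟨fun x f a o => ?_, fun x f => ?_⟩
  · unfold revealingOperation
    split_ifs <;> norm_num
  · simp [revealingOperation, ite_and]

variable [Fintype ι] [DecidableEq ι]

theorem apply_eq_of_generatedCorrelation_ne_zero [∀ k, Fintype (A k)]
    {w : (∀ k, A k) → ∀ k, X k} {f : ∀ k, X k → A k} {o : ∀ k, X k}
    (h : generatedCorrelation w (fun k => revealingOperation (X k) (A k)) f o ≠ 0) :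
    w (fun k => f k (o k)) = o := by
  obtain ⟨a, -, ha⟩ := Finset.exists_ne_zero_of_sum_ne_zero h
  have h1 : ∀ k, a k = f k (w a k) ∧ o k = w a k := fun k => by
    have := Finset.prod_ne_zero_iff.1 ha k (Finset.mem_univ _)
    simp only [revealingOperation] at this
    by_contra hk
    exact this (if_neg hk)
  have h2 : o = w a := funext fun k => (h1 k).2
  have h3 : (fun k => f k (o k)) = a := funext fun k => by rw [h2, ← (h1 k).1]
  rw [h3, h2]

theorem IsDistribution.exists_pos {I O : ι → Type} [∀ k, Fintype (O k)] {P : Correlation I O}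
    (hP : IsDistribution P) (i : ∀ k, I k) : ∃ o, 0 < P i o := by
  obtain ⟨o, -, ho⟩ := Finset.exists_ne_zero_of_sum_ne_zero
    (show ∑ o, P i o ≠ 0 by rw [hP.2]; norm_num)
  exact ⟨o, (hP.1 i o).lt_of_ne' ho⟩

/-- If a correlation that is supported on the solutions of `w` is 2-causal, then the inputs of
the members of some nonempty strict subset of parties depend on their outputs only. -/
theorem IsTwoCausalCorrelation.exists_autonomous [∀ k, Fintype (X k)]
    {w : (∀ k, A k) → ∀ k, X k} {P : Correlation (fun k => X k → A k) X}
    (hP : IsTwoCausalCorrelation P) (hsupp : ∀ f o, P f o ≠ 0 → w (fun k => f k (o k)) = o) :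
    ∃ K : Finset ι, K.Nonempty ∧ K ≠ Finset.univ ∧
      ∀ k ∈ K, ∀ a b : ∀ k, A k, (∀ l ∈ K, a l = b l) → w a k = w b k := by
  obtain ⟨q, PK, R, hq, hq1, hPK, hR, hPeq⟩ := hP
  obtain ⟨K, -, hK⟩ := Finset.exists_ne_zero_of_sum_ne_zero
    (show ∑ K, q K ≠ 0 by rw [hq1]; norm_num)
  have hKpos := (hq K).lt_of_ne' hK
  refine ⟨K.1, K.2.1, K.2.2, fun k hk a b hab => ?_⟩
  obtain ⟨oK, hoK⟩ := (hPK K).exists_pos fun l _ => a l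
  have key : ∀ c : ∀ k, A k, (∀ l ∈ K.1, a l = c l) → w c k = oK ⟨k, hk⟩ := by
    intro c hc
    have hc' : (fun (l : {l // l ∈ K.1}) (_ : X l) => a l) = fun (l : {l // l ∈ K.1}) _ => c l :=
      funext fun l => by rw [hc l l.2]
    obtain ⟨o', ho'⟩ := (hR K (fun (l : {l // l ∈ K.1}) _ => c l) oK).exists_pos fun l _ => c l
    have h1 : P (fun l _ => c l) (mergeOutputs K.1 oK o') ≠ 0 := by
      rw [hPeq]
      refine (lt_of_lt_of_le ?_ (Finset.single_le_sum (fun K' _ => mul_nonneg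
        (mul_nonneg (hq K') ((hPK K').1 _ _)) ((hR K' _ _).1 _ _)) (Finset.mem_univ K))).ne'
      have e1 : (fun l : {l // l ∈ K.1} => mergeOutputs K.1 oK o' l) = oK :=
        funext fun l => by simp [mergeOutputs, l.2]
      have e2 : (fun l : {l // l ∉ K.1} => mergeOutputs K.1 oK o' l) = o' :=
        funext fun l => by simp [mergeOutputs, l.2]
      rw [e1, e2]
      rw [hc'] at hoK
      exact mul_pos (mul_pos hKpos hoK) ho'
    have h2 := congrFun (hsupp _ _ h1) k
    simpa [mergeOutputs, hk] using h2
  rw [key a fun _ _ => rfl, key b hab]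

theorem CausalCorrelationAux.nonneg_and_exists_pos : ∀ (n : ℕ) {ι : Type u} [Fintype ι]
    [DecidableEq ι] {I O : ι → Type} [∀ k, Fintype (O k)] [∀ k, Nonempty (O k)]
    {P : Correlation I O}, CausalCorrelationAux n P →
    (∀ i o, 0 ≤ P i o) ∧ ∀ i, ∃ o, 0 < P i o
  | 0, _, _, _, _, _, _, _, P, hP => by
      rw [CausalCorrelationAux] at hP
      exact ⟨fun i o => by rw [hP]; norm_num,
        fun i => ⟨fun _ => Classical.arbitrary _, by rw [hP]; norm_num⟩⟩
  | n + 1, ι, _, _, I, O, _, _, P, hP => by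
      rw [CausalCorrelationAux] at hP
      obtain ⟨q, P₁, R, hq, hq1, hP₁, hP₁1, hR, hPeq⟩ := hP
      have hterm : ∀ (i : ∀ k, I k) (o : ∀ k, O k) (k : ι), 0 ≤ q k * P₁ k (i k) (o k) *
          R k (i k) (o k) (fun l => i l) (fun l => o l) := fun i o k =>
        mul_nonneg (mul_nonneg (hq k) (hP₁ _ _ _)) ((nonneg_and_exists_pos n (hR _ _ _)).1 _ _)
      refine ⟨fun i o => ?_, fun i => ?_⟩
      · rw [hPeq]
        exact Finset.sum_nonneg fun k _ => hterm i o k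
      · obtain ⟨k, -, hk⟩ := Finset.exists_ne_zero_of_sum_ne_zero
          (show ∑ k, q k ≠ 0 by rw [hq1]; norm_num)
        obtain ⟨x, -, hx⟩ := Finset.exists_ne_zero_of_sum_ne_zero
          (show ∑ o, P₁ k (i k) o ≠ 0 by rw [hP₁1]; norm_num)
        obtain ⟨o, ho⟩ := (nonneg_and_exists_pos n (hR k (i k) x)).2 fun l => i l
        refine ⟨(Equiv.piSplitAt k O).symm (x, o), ?_⟩
        rw [hPeq]
        refine lt_of_lt_of_le ?_
          (Finset.single_le_sum (fun l _ => hterm i _ l) (Finset.mem_univ k))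
        have e1 : (Equiv.piSplitAt k O).symm (x, o) k = x := by simp
        have e2 : (fun l : {l // l ≠ k} => (Equiv.piSplitAt k O).symm (x, o) l) = o :=
          funext fun l => by simp [l.2]
        rw [e1, e2]
        exact mul_pos (mul_pos ((hq k).lt_of_ne' hk) ((hP₁ _ _ _).lt_of_ne' hx)) ho

/-- A consistent function is dynamically ordered if some causal correlation is supported on its
solutions. -/
theorem CausalCorrelationAux.isDynamicallyOrdered : ∀ (n : ℕ) {ι : Type u} [Fintype ι]
    [DecidableEq ι] {A X : ι → Type} [∀ k, Fintype (X k)] [∀ k, Nonempty (X k)]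
    {w : (∀ k, A k) → ∀ k, X k} {P : Correlation (fun k => X k → A k) X},
    Fintype.card ι = n → IsConsistent w → CausalCorrelationAux n P →
    (∀ f o, P f o ≠ 0 → w (fun k => f k (o k)) = o) → IsDynamicallyOrdered w
  | 0, ι, _, _, _, _, _, _, _, _, hn, _, _, _ => fun K hK _ => by
      have := Fintype.card_eq_zero_iff.1 hn
      exact absurd (Subsingleton.elim _ _) hK
  | n + 1, ι, _, _, A, X, _, _, w, P, hn, hw, hP, hsupp => by
      rw [CausalCorrelationAux] at hP
      obtain ⟨q, P₁, R, hq, hq1, hP₁, hP₁1, hR, hPeq⟩ := hP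
      obtain ⟨k, -, hk⟩ := Finset.exists_ne_zero_of_sum_ne_zero
        (show ∑ k, q k ≠ 0 by rw [hq1]; norm_num)
      have hkpos := (hq k).lt_of_ne' hk
      have hsolve : ∀ (f : ∀ l, X l → A l) (x : X k) (o : ∀ l : {l // l ≠ k}, X l),
          P₁ k (f k) x ≠ 0 → R k (f k) x (fun l => f l) o ≠ 0 →
          w (fun l => f l ((Equiv.piSplitAt k X).symm (x, o) l)) =
            (Equiv.piSplitAt k X).symm (x, o) := by
        intro f x o hx ho
        apply hsupp
        have e1 : (Equiv.piSplitAt k X).symm (x, o) k = x := by simp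
        have e2 : (fun l : {l // l ≠ k} => (Equiv.piSplitAt k X).symm (x, o) l) = o :=
          funext fun l => by simp [l.2]
        rw [hPeq]
        refine (lt_of_lt_of_le ?_ (Finset.single_le_sum (fun l _ => mul_nonneg
          (mul_nonneg (hq l) (hP₁ _ _ _)) ((nonneg_and_exists_pos n (hR _ _ _)).1 _ _))
          (Finset.mem_univ k))).ne'
        rw [e1, e2]
        exact mul_pos (mul_pos hkpos ((hP₁ _ _ _).lt_of_ne' hx))
          (((nonneg_and_exists_pos n (hR _ _ _)).1 _ _).lt_of_ne' ho)
      have hpos : ∀ g : X k → A k, ∃ x, P₁ k g x ≠ 0 := fun g => by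
        obtain ⟨x, -, hx⟩ := Finset.exists_ne_zero_of_sum_ne_zero
          (show ∑ o, P₁ k g o ≠ 0 by rw [hP₁1]; norm_num)
        exact ⟨x, hx⟩
      have hval : ∀ (a : ∀ l, A l) (x : X k), P₁ k (fun _ => a k) x ≠ 0 → w a k = x := by
        intro a x hx
        obtain ⟨o, ho⟩ := (nonneg_and_exists_pos n (hR k (fun _ => a k) x)).2 fun l _ => a l
        have := congrFun (hsolve (fun l _ => a l) x o hx ho.ne') k
        simpa using this
      have hconst : ∀ a b : ∀ l, A l, w a k = w b k := by
        intro a b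
        obtain ⟨x, hx⟩ := hpos fun _ => b k
        have h1 : w (Function.update a k (b k)) k = x := hval _ x (by simpa using hx)
        rw [hval b x hx, ← h1]
        exact hw.apply_eq fun l hl => by simp [hl]
      intro K hK a
      by_cases hkK : k ∈ K
      swap
      · exact ⟨k, hkK, fun b c _ _ => hconst b c⟩
      obtain ⟨x, hx⟩ := hpos fun _ => a k
      let ext : (∀ l : {l // l ≠ k}, A l) → ∀ l, A l :=
        fun b => (Equiv.piSplitAt k A).symm (a k, b)
      have ext_self : ∀ b, ext b k = a k := fun b => by simp [ext]
      have ext_ne : ∀ b l (hl : l ≠ k), ext b l = b ⟨l, hl⟩ := fun b l hl => by simp [ext, hl]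
      have hcons : IsConsistent (fun (b : ∀ l : {l // l ≠ k}, A l) (l : {l // l ≠ k}) =>
          w (ext b) l) := by
        intro b c hbc
        obtain ⟨l, hl⟩ := Function.ne_iff.1 hbc
        obtain ⟨m, hm, hm'⟩ := hw (ext b) (ext c) fun h => hl (by
          rw [← ext_ne b l l.2, h, ext_ne c l l.2])
        have hmk : m ≠ k := fun h => hm (by rw [h, ext_self, ext_self])
        refine ⟨⟨m, hmk⟩, ?_, hm'⟩
        rwa [ext_ne b m hmk, ext_ne c m hmk] at hm
      have hcard : Fintype.card {l // l ≠ k} = n := by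
        rw [Fintype.card_subtype_compl, Fintype.card_subtype_eq, hn]
        omega
      have ih := isDynamicallyOrdered n hcard hcons (hR k (fun _ => a k) x) (by
        intro f o ho
        let f' : ∀ l, X l → A l := fun l y => if hl : l = k then hl ▸ a k else f ⟨l, hl⟩ y
        have f'_self : f' k = fun _ => a k := by funext y; simp [f']
        have f'_ne : (fun l : {l // l ≠ k} => f' l) = f := by
          funext l y; simp [f', l.2]
        have := hsolve f' x o (by rwa [f'_self]) (by rwa [f'_self, f'_ne])
        have he : (fun l => f' l ((Equiv.piSplitAt k X).symm (x, o) l)) =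
            ext fun l => f l (o l) := by
          funext l
          by_cases hl : l = k
          · subst hl
            rw [ext_self, f'_self]
          · rw [ext_ne _ l hl]
            simp [f', hl]
        funext l
        rw [he] at this
        have := congrFun this l
        simpa [l.2] using this)
      obtain ⟨l, hl, hdet⟩ := ih (K.subtype (fun l => l ≠ k)) (by
        intro h
        apply hK
        rw [Finset.eq_univ_iff_forall] at h ⊢
        intro m
        by_cases hm : m = k
        · rwa [hm]
        · simpa using h ⟨m, hm⟩) fun l => a l
      refine ⟨l, fun h => hl (by simpa using h), fun b c hb hc => ?_⟩
      have hext : ∀ b : ∀ l, A l, (∀ m ∈ K, b m = a m) → ext (fun m => b m) = b := by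
        intro b hb
        funext m
        by_cases hm : m = k
        · rw [hm, ext_self, hb k hkK]
        · rw [ext_ne _ m hm]
      have := hdet (fun m => b m) (fun m => c m) (fun m hm => hb m (by simpa using hm))
        fun m hm => hc m (by simpa using hm)
      simpa only [hext b hb, hext c hc] using this

theorem IsCausalProcess.isDynamicallyOrdered {ι : Type} [Fintype ι] [DecidableEq ι]
    {A X : ι → Type} [∀ k, Fintype (A k)] [∀ k, Nonempty (A k)] [∀ k, Finite (X k)]
    [∀ k, Nonempty (X k)] {w : (∀ k, A k) → ∀ k, X k} (hw : IsConsistent w)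
    (hcausal : IsCausalProcess w) : IsDynamicallyOrdered w := by
  classical
  have (k : ι) : Fintype (X k) := Fintype.ofFinite _
  exact CausalCorrelationAux.isDynamicallyOrdered _ rfl hw
    (hcausal _ _ _ fun k => isLocalOperation_revealingOperation (X k) (A k))
    fun f o => apply_eq_of_generatedCorrelation_ne_zero

theorem exists_outputReduced_generatesGenuineNonCausality [∀ k, Fintype (A k)]
    [∀ k, Nonempty (A k)] [∀ k, Finite (X k)] [∀ k, Nonempty (X k)]
    {w : (∀ k, A k) → ∀ k, X k} (hw : IsConsistent w) (h : ¬ IsDynamicallyOrdered w) :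
    ∃ (K : Finset ι) (a : ∀ k, A k), K ≠ Finset.univ ∧
      (∀ l ∉ K, ¬ DeterminedAfter w K a l) ∧
      GeneratesGenuineNonCausality (outputReduced w K fun k => a k) := by
  classical
  have (k : ι) : Fintype (X k) := Fintype.ofFinite _
  let T : Finset (Finset ι) := Finset.univ.filter fun K =>
    K ≠ Finset.univ ∧ ∃ a, ∀ l ∉ K, ¬ DeterminedAfter w K a l
  have hT : T.Nonempty := by
    simp only [IsDynamicallyOrdered, not_forall] at h
    obtain ⟨K, hK, a, ha⟩ := h
    refine ⟨K, ?_⟩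
    simp only [T, Finset.mem_filter, Finset.mem_univ, true_and]
    exact ⟨hK, a, fun l hl hdet => ha ⟨l, hl, hdet⟩⟩
  obtain ⟨K, hKT, hmax⟩ := T.exists_max_image Finset.card hT
  simp only [T, Finset.mem_filter, Finset.mem_univ, true_and] at hKT hmax
  obtain ⟨hK, a, ha⟩ := hKT
  refine ⟨K, a, hK, ha, ?_, fun k => X k → A k, fun k => X k, fun k => inferInstance,
    fun k => inferInstance, fun k => inferInstance, fun k => inferInstance,
    fun k => revealingOperation (X k) (A k),
    fun k => isLocalOperation_revealingOperation (X k) (A k), fun htwo => ?_⟩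
  · obtain ⟨k, hk⟩ : ∃ k, k ∉ K := by
      by_contra! hall
      exact hK (Finset.eq_univ_iff_forall.2 hall)
    have : Nontrivial {k // k ∉ K} := by
      by_contra hsub
      rw [not_nontrivial_iff_subsingleton] at hsub
      refine ha k hk fun b c hb hc => hw.apply_eq fun l hl => ?_
      by_cases hlK : l ∈ K
      · rw [hb l hlK, hc l hlK]
      · exact absurd (congrArg Subtype.val (Subsingleton.elim
          (⟨l, hlK⟩ : {k // k ∉ K}) ⟨k, hk⟩)) hl
    exact Fintype.one_lt_card
  · obtain ⟨M, hM, hMne, haut⟩ := htwo.exists_autonomous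
      fun f o => apply_eq_of_generatedCorrelation_ne_zero
    let K' : Finset ι := (M.map (Function.Embedding.subtype _))ᶜ
    have hK' : ∀ l, l ∉ K' ↔ ∃ hl : l ∉ K, (⟨l, hl⟩ : {k // k ∉ K}) ∈ M := fun l => by
      simp [K']
    have hsub : K ⊂ K' := by
      refine Finset.ssubset_iff_subset_ne.2 ⟨fun l hl => ?_, fun heq => hMne ?_⟩
      · by_contra hl'
        exact ((hK' l).1 hl').1 hl
      · rw [Finset.eq_univ_iff_forall]
        rintro ⟨l, hl⟩
        have hl' := hl
        rw [heq] at hl'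
        exact ((hK' l).1 hl').2
    refine absurd (Finset.card_lt_card hsub) (not_lt.2 (hmax K' ⟨fun hu => ?_, a, ?_⟩))
    · obtain ⟨m, hm⟩ := hM
      exact (hK' m).2 ⟨m.2, hm⟩ (hu ▸ Finset.mem_univ _)
    · intro l hl hdet
      obtain ⟨hlK, hlM⟩ := (hK' l).1 hl
      refine ha l hlK fun b c hb hc => ?_
      have key : ∀ b : ∀ k, A k, (∀ k ∈ K, b k = a k) →
          w b l = w (fun k => if k ∈ K' then a k else b k) l := by
        intro b hb
        have hmerge : ∀ e : ∀ k, A k, (∀ k ∈ K, e k = a k) →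
            mergeOutputs K (fun k => a k) (fun k => e k) = e := by
          intro e he
          funext k
          by_cases hk : k ∈ K <;> simp [mergeOutputs, hk, he]
        have := haut ⟨l, hlK⟩ hlM (fun k => b k) (fun k => if k.1 ∈ K' then a k else b k)
          fun m hm => by rw [if_neg ((hK' m).2 ⟨m.2, hm⟩)]
        simp only [outputReduced] at this
        rw [hmerge b hb, hmerge (fun k => if k ∈ K' then a k else b k) fun k hk => by
          simp [hsub.1 hk]] at this
        exact this
      rw [key b hb, key c hc]
      exact hdet _ _ (fun k hk => by simp [hk]) fun k hk => by simp [hk]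

end Revealing

/-! ### Discrimination by adaptive local measurements -/

section Protocols

variable {ι : Type u} [Fintype ι] [DecidableEq ι]

theorem applyLocal_zero {d e : ι → ℕ} (M : ∀ k, Matrix (Fin (e k)) (Fin (d k)) ℂ) :
    applyLocal M (0 : JointSpace d) = 0 := by
  ext b
  simp [applyLocal]

theorem LOCCProtocol.prob_zero {R : Type v} {d : ι → ℕ} (p : LOCCProtocol R d) (r : R) :
    p.prob 0 r = 0 := by
  induction p with
  | halt d r' => simp [LOCCProtocol.prob]
  | round d m e K complete next ih => simp [LOCCProtocol.prob, applyLocal_zero, ih]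

theorem applyLocal_product {d e : ι → ℕ} (M : ∀ k, Matrix (Fin (e k)) (Fin (d k)) ℂ)
    (v : ∀ k, EuclideanSpace ℂ (Fin (d k))) :
    applyLocal M (WithLp.toLp 2 (fun a => ∏ k, v k (a k)) : JointSpace d) =
      WithLp.toLp 2 (fun b => ∏ k, (M k *ᵥ v k) (b k)) := by
  unfold applyLocal
  congr 1
  funext b
  simp only [Matrix.mulVec, dotProduct]
  rw [Fintype.prod_sum]
  exact Finset.sum_congr rfl fun a _ => Finset.prod_mul_distrib.symm

theorem inner_product {d : ι → ℕ} (u v : ∀ k, EuclideanSpace ℂ (Fin (d k))) :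
    inner ℂ (WithLp.toLp 2 (fun a => ∏ k, u k (a k)) : JointSpace d)
      (WithLp.toLp 2 (fun a => ∏ k, v k (a k)) : JointSpace d) = ∏ k, inner ℂ (u k) (v k) := by
  simp only [PiLp.inner_apply]
  rw [Fintype.prod_sum]
  refine Finset.sum_congr rfl fun a _ => ?_
  simp [Finset.prod_mul_distrib]

/-- The rank-one projector onto a unit vector. -/
def projector {n : ℕ} (v : EuclideanSpace ℂ (Fin n)) : Matrix (Fin n) (Fin n) ℂ :=
  Matrix.vecMulVec v (star v.ofLp)

theorem projector_mulVec {n : ℕ} (u v : EuclideanSpace ℂ (Fin n)) :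
    projector u *ᵥ v.ofLp = (inner ℂ u v : ℂ) • u.ofLp := by
  funext i
  simp [projector, Matrix.mulVec, dotProduct, Matrix.vecMulVec_apply, PiLp.inner_apply,
    Finset.sum_mul]
  exact Finset.sum_congr rfl fun j _ => by ring

theorem sum_projector {n : ℕ} {u : Fin n → EuclideanSpace ℂ (Fin n)} (hu : Orthonormal ℂ u) :
    ∑ s, (projector (u s))ᴴ * projector (u s) = 1 := by
  have h1 : ∀ s, (projector (u s))ᴴ * projector (u s) = projector (u s) := by
    intro s
    have hs : star (u s).ofLp ⬝ᵥ (u s).ofLp = 1 := by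
      have := orthonormal_iff_ite.1 hu s s
      rw [if_pos rfl, PiLp.inner_apply] at this
      rw [dotProduct, ← this]
      exact Finset.sum_congr rfl fun i _ => mul_comm _ _
    have hH : (projector (u s))ᴴ = projector (u s) := by
      simp [projector, Matrix.conjTranspose_vecMulVec]
    rw [hH]
    simp only [projector]
    rw [Matrix.vecMulVec_mul_vecMulVec, hs]
    simp
  simp_rw [h1]
  let U : Matrix (Fin n) (Fin n) ℂ := Matrix.of fun s i => star (u s i)
  have hU : U * Uᴴ = 1 := by
    ext s t
    have := orthonormal_iff_ite.1 hu s t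
    rw [PiLp.inner_apply] at this
    simpa [U, Matrix.mul_apply, Matrix.one_apply, mul_comm] using this
  rw [← mul_eq_one_comm.1 hU]
  ext i j
  simp [U, Matrix.mul_apply, projector, Matrix.sum_apply, Matrix.vecMulVec_apply]

end Protocols

namespace ProductBasis

variable {ι : Type u} [Fintype ι] [DecidableEq ι] {d : ι → ℕ} {J : Type v} [Fintype J]

theorem norm_state (S : ProductBasis d J) (j : J) : ‖S.state j‖ = 1 := by
  have h : (inner ℂ (S.state j) (S.state j) : ℂ) = 1 := by
    unfold state
    rw [inner_product]
    exact Finset.prod_eq_one fun k _ => by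
      rw [inner_self_eq_norm_sq_to_K, S.norm_vec]; norm_num
  rw [inner_self_eq_norm_sq_to_K] at h
  have h' : ‖S.state j‖ ^ 2 = 1 := Complex.ofReal_injective (by simpa using h)
  exact (pow_eq_one_iff_of_nonneg (norm_nonneg _) two_ne_zero).1 h'

theorem exists_inner_eq_zero (S : ProductBasis d J) {i j : J} (hij : i ≠ j) :
    ∃ k, (inner ℂ (S.vec i k) (S.vec j k) : ℂ) = 0 := by
  have := S.orthogonal i j hij
  rw [inner_product, Finset.prod_eq_zero_iff] at this
  obtain ⟨k, -, hk⟩ := this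
  exact ⟨k, hk⟩

theorem vec_ne_of_inner_eq_zero (S : ProductBasis d J) {i j : J} {k : ι}
    (h : (inner ℂ (S.vec i k) (S.vec j k) : ℂ) = 0) : S.vec i k ≠ S.vec j k := by
  intro heq
  rw [heq, inner_self_eq_zero] at h
  have := S.norm_vec j k
  rw [h, norm_zero] at this
  exact zero_ne_one this

/-- If some local space is trivial, the basis is empty and measuring it never yields a result. -/
theorem IsQNLWE.dim_pos {S : ProductBasis d J} (hS : S.IsQNLWE) (k : ι) : 0 < d k := by
  by_contra hk
  have hk0 : d k = 0 := by omega
  have hJ : IsEmpty J := by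
    rw [← Fintype.card_eq_zero_iff, S.complete]
    exact Finset.prod_eq_zero (Finset.mem_univ k) hk0
  refine hS ⟨.round d d (fun l _ => d l) (fun l s => projector (EuclideanSpace.basisFun _ ℂ s))
    (fun l => sum_projector (EuclideanSpace.basisFun _ ℂ).orthonormal) fun s => ?_,
    fun j => hJ.elim j⟩
  have := s k
  rw [hk0] at this
  exact this.elim0

end ProductBasis

namespace EventLabelling

variable {ι : Type u} [Fintype ι] [DecidableEq ι] {d : ι → ℕ} {J : Type v} [Fintype J]
  {S : ProductBasis d J} {X : ι → Type} {E : EventLabelling S X}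

/-- Distinct basis elements differ in the outcome of a party that has the same setting. -/
theorem Unambiguous.exists_outcome_ne (hE : E.Unambiguous) {i j : J} (hij : i ≠ j) :
    ∃ k, E.outcome i k ≠ E.outcome j k ∧ E.setting i k = E.setting j k := by
  obtain ⟨k, hk⟩ := S.exists_inner_eq_zero hij
  have hne := S.vec_ne_of_inner_eq_zero hk
  have hset := (hE k i j hne).1 hk
  exact ⟨k, fun h => hne ((E.vec_eq_iff k i j).2 ⟨hset, h⟩), hset⟩

theorem Unambiguous.outcome_bijective (hE : E.Unambiguous) :
    Function.Bijective E.outcome := by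
  rw [Fintype.bijective_iff_injective_and_card]
  refine ⟨fun i j h => ?_, by simp [S.complete]⟩
  by_contra hij
  obtain ⟨k, hk, -⟩ := hE.exists_outcome_ne hij
  exact hk (congrFun h k)

theorem exists_protocol (hbij : Function.Bijective E.outcome)
    {w : (∀ k, Fin (d k)) → ∀ k, X k} (hw : E.Induces w) (hord : IsDynamicallyOrdered w) :
    ∀ (n : ℕ) (K : Finset ι), Kᶜ.card = n → ∀ a : ∀ k, Fin (d k), ∃ p : LOCCProtocol J d,
      ∀ j, (∀ k ∈ K, E.outcome j k = a k) → p.prob (S.state j) j = 1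
  | 0, K, hK, a => by
      have hK' : K = Finset.univ := by simpa using hK
      obtain ⟨j₀, hj₀⟩ := hbij.2 a
      refine ⟨.halt d j₀, fun j hj => ?_⟩
      have : j₀ = j := hbij.1 (by
        rw [hj₀]
        exact (funext fun k => hj k (hK' ▸ Finset.mem_univ k)).symm)
      simp [LOCCProtocol.prob, this, S.norm_state]
  | n + 1, K, hK, a => by
      have hKne : K ≠ Finset.univ := fun h => by simp [h] at hK
      obtain ⟨l, hl, hdet⟩ := hord K hKne a
      have hcard : (insert l K)ᶜ.card = n := by
        rw [Finset.card_compl, Finset.card_insert_of_notMem hl, ← Nat.sub_sub,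
          ← Finset.card_compl, hK]
        omega
      choose p hp using fun s : Fin (d l) =>
        exists_protocol hbij hw hord n (insert l K) hcard (Function.update a l s)
      choose g hg using hbij.2
      let u : ∀ k, Fin (d k) → EuclideanSpace ℂ (Fin (d k)) := fun k s =>
        S.vec (g (Function.update a k s)) k
      have hset : ∀ i j, (∀ k ∈ K, E.outcome i k = a k) → (∀ k ∈ K, E.outcome j k = a k) →
          E.setting i l = E.setting j l := fun i j hi hj => by
        rw [← hw i, ← hw j]
        exact hdet _ _ hi hj
      have hgK : ∀ s, ∀ k ∈ K, E.outcome (g (Function.update a l s)) k = a k := by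
        intro s k hk
        rw [hg, Function.update_of_ne (ne_of_mem_of_not_mem hk hl)]
      have hvec : ∀ j, (∀ k ∈ K, E.outcome j k = a k) → S.vec j l = u l (E.outcome j l) := by
        intro j hj
        refine (E.vec_eq_iff _ _ _).2 ⟨hset _ _ hj (hgK _), ?_⟩
        rw [hg, Function.update_self]
      have hu : Orthonormal ℂ (u l) := by
        refine ⟨fun s => S.norm_vec _ _, fun s t hst => ?_⟩
        refine E.orthogonal_of_setting_eq l _ _ (hset _ _ (hgK s) (hgK t)) fun h => hst ?_
        have := ((E.vec_eq_iff _ _ _).1 h).2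
        rwa [hg, hg, Function.update_self, Function.update_self] at this
      let M : ∀ k, Fin (d k) → Matrix (Fin (d k)) (Fin (d k)) ℂ := fun k s =>
        if k = l then projector (u k s) else if s = a k then 1 else 0
      have hM : ∀ k, ∑ s, (M k s)ᴴ * M k s = 1 := by
        intro k
        by_cases hk : k = l
        · subst hk
          simpa [M] using sum_projector hu
        · rw [Finset.sum_eq_single (a k)]
          · simp [M, hk]
          · intro s _ hs
            simp [M, hk, hs]
          · simp
      refine ⟨.round d d (fun k _ => d k) M hM fun s => p (s l), fun j hj => ?_⟩
      rw [LOCCProtocol.prob, Finset.sum_eq_single (Function.update a l (E.outcome j l))]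
      · have hstate : applyLocal (fun k => M k (Function.update a l (E.outcome j l) k))
            (S.state j) = S.state j := by
          unfold ProductBasis.state
          rw [applyLocal_product]
          congr 1
          funext b
          refine Finset.prod_congr rfl fun k _ => ?_
          by_cases hk : k = l
          · subst hk
            simp only [M, if_true, Function.update_self]
            rw [← hvec j hj, projector_mulVec, inner_self_eq_norm_sq_to_K, S.norm_vec]
            simp
          · simp [M, hk]
        rw [hstate, Function.update_self]
        refine hp _ j fun k hk => ?_
        by_cases hkl : k = l
        · subst hkl
          rw [Function.update_self]
        · rw [Function.update_of_ne hkl]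
          exact hj k (Finset.mem_of_mem_insert_of_ne hk hkl)
      · intro s _ hs
        have hstate : applyLocal (fun k => M k (s k)) (S.state j) = 0 := by
          obtain ⟨k, hk⟩ := Function.ne_iff.1 hs
          unfold ProductBasis.state
          rw [applyLocal_product]
          ext b
          refine Finset.prod_eq_zero (Finset.mem_univ k) ?_
          by_cases hkl : k = l
          · subst hkl
            rw [Function.update_self] at hk
            simp only [M, if_true]
            rw [projector_mulVec, hvec j hj, hu.2 hk]
            simp
          · rw [Function.update_of_ne hkl] at hk
            simp [M, hkl, hk]
        rw [hstate]
        exact LOCCProtocol.prob_zero _ _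
      · simp

end EventLabelling

theorem corollary1 {ι : Type} [Fintype ι] [DecidableEq ι] {d : ι → ℕ} {J : Type} [Fintype J]
    (S : ProductBasis d J) {X : ι → Type} (E : EventLabelling S X)
    (hE : E.Unambiguous) (hS : S.IsQNLWE) :
    ∃ w : (∀ k, Fin (d k)) → ∀ k, X k,
      E.Induces w ∧ (∀ w', E.Induces w' → w' = w) ∧
      IsProcessFunction w ∧ ¬ IsCausalProcess w ∧
      (WithoutGlobalPast w ∨
        (¬ WithoutGlobalPast w ∧ ¬ GeneratesGenuineNonCausality w ∧
          ∃ (K : Finset ι) (aK : ∀ k : {k // k ∈ K}, Fin (d k)),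
            K.Nonempty ∧ K ≠ Finset.univ ∧
            IsProcessFunction (outputReduced w K aK) ∧
            WithoutGlobalPast (outputReduced w K aK) ∧
            GeneratesGenuineNonCausality (outputReduced w K aK))) := by
  have hbij := hE.outcome_bijective
  have hdim := hS.dim_pos
  have hA (k : ι) : Nonempty (Fin (d k)) := ⟨⟨0, hdim k⟩⟩
  obtain ⟨j₀, -⟩ := hbij.2 fun k => ⟨0, hdim k⟩
  have hXfin (k : ι) : Finite (X k) :=
    Finite.of_surjective (fun j => E.setting j k) (E.setting_surjective k)
  have hXne (k : ι) : Nonempty (X k) := ⟨E.setting j₀ k⟩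
  choose g hg using hbij.2
  let w : (∀ k, Fin (d k)) → ∀ k, X k := fun a => E.setting (g a)
  have hind : E.Induces w := fun j => by
    simp only [w]
    rw [hbij.1 (hg (E.outcome j))]
  have hcons : IsConsistent w := fun a b hab => by
    obtain ⟨k, hk, hk'⟩ := hE.exists_outcome_ne (i := g a) (j := g b) fun h => hab (by
      rw [← hg a, ← hg b, h])
    rw [hg, hg] at hk
    exact ⟨k, hk, hk'⟩
  have hord : ¬ IsDynamicallyOrdered w := fun hord => hS (by
    obtain ⟨p, hp⟩ := E.exists_protocol hbij hind hord _ ∅ rfl (E.outcome j₀)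
    exact ⟨p, fun j => hp j (by simp)⟩)
  refine ⟨w, hind, fun w' hw' => ?_, hcons.isProcessFunction,
    fun hc => hord (hc.isDynamicallyOrdered hcons), ?_⟩
  · funext a
    rw [← hg a, hw', hind]
  by_cases hpast : WithoutGlobalPast w
  · exact Or.inl hpast
  refine Or.inr ⟨hpast, not_generatesGenuineNonCausality hcons hpast, ?_⟩
  obtain ⟨K, a, hK, hdet, hgen⟩ := exists_outputReduced_generatesGenuineNonCausality hcons hord
  refine ⟨K, fun k => a k, ?_, hK, (hcons.outputReduced K _).isProcessFunction,
    withoutGlobalPast_outputReduced hdet, hgen⟩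
  simp only [WithoutGlobalPast, not_forall, not_not] at hpast
  obtain ⟨k, x, hx⟩ := hpast
  refine ⟨k, ?_⟩
  by_contra hk
  exact hdet k hk fun b c _ _ => by rw [hx, hx]
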